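/- Let $\mathbb K=\mathbb R$ or $\mathbb C$; all Banach spaces are over $\mathbb K$ and all operators are bounded and linear. A Banach space $X$ has the bounded approximation property (BAP) if there is a constant $\lambda$ such that for every finite-dimensional subspace $F\subset X$ there is a finite-rank operator $T:X\to X$ with $\|T\|\le\lambda$ and $T(f)=f$ for all $f\in F$. A Banach space $X$ is an $\mathcal L_\infty$-space if there is a constant $\lambda$ such that every finite-dimensional subspace of $X$ is contained in a finite-dimensional subspace $G\subset X$ for which, with $n=\dim G$, there is a linear isomorphism $u:G\to\ell_\infty^n$ with $\|u\|\,\|u^{-1}\|\le\lambda$. **Proposition.** Let $Y,Z,Z'$ be Banach spaces, let $E$ and $E'$ be $\mathcal L_\infty$-spaces, and let $$0\to Y\xrightarrow{\,i\,}E\xrightarrow{\,q\,}Z\to0\qquad\text{and}\qquad 0\to Y\xrightarrow{\,i'\,}E'\xrightarrow{\,q'\,}Z'\to0$$ be exact sequences of Banach spaces and operators, with the same space $Y$ on the left. Then $Z$ has the BAP if and only if $Z'$ has the BAP. -/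

import Mathlib

/-- `X` has the `c`-bounded approximation property (`c`-BAP): for every finite dimensional subspace
`F` of `X` there is a finite rank bounded operator `T : X → X` with `‖T‖ ≤ c` and `T f = f` for all
`f ∈ F`. -/
def HasBAPWith (𝕜 : Type*) [RCLike 𝕜] (X : Type*) [NormedAddCommGroup X] [NormedSpace 𝕜 X]
    (c : ℝ) : Prop :=
  ∀ F : Submodule 𝕜 X, FiniteDimensional 𝕜 F →
    ∃ T : X →L[𝕜] X, FiniteDimensional 𝕜 (LinearMap.range (T : X →ₗ[𝕜] X)) ∧
      ‖T‖ ≤ c ∧ ∀ f ∈ F, T f = f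

/-- `X` has the bounded approximation property (BAP): it has the `c`-BAP for some constant `c`. -/
def HasBAP (𝕜 : Type*) [RCLike 𝕜] (X : Type*) [NormedAddCommGroup X] [NormedSpace 𝕜 X] : Prop :=
  ∃ c : ℝ, HasBAPWith 𝕜 X c

/-- `X` is an `𝓛_{∞,c}`-space: every finite dimensional subspace `F` of `X` is contained in a finite
dimensional subspace `G` of `X` which is `c`-isomorphic to `ℓ_∞^n` for some `n` (here `Fin n → 𝕜`
carries the sup norm; necessarily `n = dim G`). -/
def IsScriptLInftyWith (𝕜 : Type*) [RCLike 𝕜] (X : Type*) [NormedAddCommGroup X] [NormedSpace 𝕜 X]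
    (c : ℝ) : Prop :=
  ∀ F : Submodule 𝕜 X, FiniteDimensional 𝕜 F →
    ∃ G : Submodule 𝕜 X, F ≤ G ∧ ∃ (n : ℕ) (e : G ≃L[𝕜] (Fin n → 𝕜)),
      ‖(e : G →L[𝕜] (Fin n → 𝕜))‖ * ‖(e.symm : (Fin n → 𝕜) →L[𝕜] G)‖ ≤ c

/-- `X` is an `𝓛_∞`-space: it is an `𝓛_{∞,c}`-space for some constant `c`. -/
def IsScriptLInfty (𝕜 : Type*) [RCLike 𝕜] (X : Type*) [NormedAddCommGroup X] [NormedSpace 𝕜 X] :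
    Prop :=
  ∃ c : ℝ, IsScriptLInftyWith 𝕜 X c

/-- `0 → Y → X → Z → 0`, with bounded linear maps `i : Y → X` and `q : X → Z`, is exact. -/
def IsShortExactSeq {𝕜 : Type*} [RCLike 𝕜] {Y X Z : Type*}
    [NormedAddCommGroup Y] [NormedSpace 𝕜 Y] [NormedAddCommGroup X] [NormedSpace 𝕜 X]
    [NormedAddCommGroup Z] [NormedSpace 𝕜 Z] (i : Y →L[𝕜] X) (q : X →L[𝕜] Z) : Prop :=
  Function.Injective i ∧ Function.Exact i q ∧ Function.Surjective q

open Filter Topology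

universe u v

/-! The push-out `P` of `i` and `i'` sits in exact sequences `0 → E → P → Z' → 0` and `0 → E' → P →
Z → 0`. So it suffices that, in `0 → A → B → C → 0` with `A` an `𝓛_∞`-space, the BAP passes between
`B` and `C`; it then travels from `Z` to `P` to `Z'` and back. Both passages (`hasBAP_middle`,
`hasBAP_right`) hold because finite rank operators into `A` extend with uniform bounds, which yields
uniformly bounded sections over finite dimensional subspaces of `C`. -/

/-! ### Extension of operators with values in an `𝓛_∞`-space -/

theorem IsScriptLInftyWith.nonneg {𝕜 : Type*} [RCLike 𝕜] {A : Type*} [NormedAddCommGroup A]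
    [NormedSpace 𝕜 A] {c : ℝ} (hA : IsScriptLInftyWith 𝕜 A c) : 0 ≤ c := by
  obtain ⟨G, -, n, e, he⟩ := hA ⊥ inferInstance
  exact le_trans (by positivity) he

/-- Finite rank operators into an `𝓛_∞`-space extend from any subspace, with norm control. -/
theorem IsScriptLInftyWith.exists_extension {𝕜 : Type*} [RCLike 𝕜] {A X : Type*}
    [NormedAddCommGroup A] [NormedSpace 𝕜 A] [NormedAddCommGroup X] [NormedSpace 𝕜 X]
    {c : ℝ} (hA : IsScriptLInftyWith 𝕜 A c) (V : Submodule 𝕜 X) (t : V →L[𝕜] A)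
    (ht : FiniteDimensional 𝕜 (LinearMap.range (t : V →ₗ[𝕜] A))) :
    ∃ g : X →L[𝕜] A, (∀ v : V, g v = t v) ∧ ‖g‖ ≤ c * ‖t‖ ∧
      FiniteDimensional 𝕜 (LinearMap.range (g : X →ₗ[𝕜] A)) := by
  obtain ⟨G, hG, n, e, he⟩ := hA _ ht
  have : FiniteDimensional 𝕜 G := e.symm.toLinearEquiv.finiteDimensional
  let t' : V →L[𝕜] G := t.codRestrict G fun v => hG ⟨v, rfl⟩
  have ht' : ‖t'‖ ≤ ‖t‖ := ContinuousLinearMap.opNorm_le_bound _ (norm_nonneg _) fun v => by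
    simpa [t'] using t.le_opNorm v
  let f : V →L[𝕜] (Fin n → 𝕜) := (e : G →L[𝕜] (Fin n → 𝕜)).comp t'
  have hf : ‖f‖ ≤ ‖(e : G →L[𝕜] (Fin n → 𝕜))‖ * ‖t‖ :=
    (ContinuousLinearMap.opNorm_comp_le _ _).trans (by gcongr)
  -- Hahn–Banach in each coordinate; the sup norm makes this cost nothing.
  choose g hg hgn using fun k : Fin n =>
    exists_extension_norm_eq V ((ContinuousLinearMap.proj k : (Fin n → 𝕜) →L[𝕜] 𝕜).comp f)
  have hgf : ‖ContinuousLinearMap.pi g‖ ≤ ‖f‖ := by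
    refine ContinuousLinearMap.opNorm_le_bound _ (norm_nonneg _) fun x => ?_
    refine (pi_norm_le_iff_of_nonneg (by positivity)).2 fun k => ?_
    refine ((g k).le_opNorm x).trans ?_
    rw [hgn]
    gcongr
    refine ContinuousLinearMap.opNorm_le_bound _ (norm_nonneg _) fun v => ?_
    exact (norm_le_pi_norm (f v) k).trans (f.le_opNorm v)
  let r : X →L[𝕜] G := (e.symm : (Fin n → 𝕜) →L[𝕜] G).comp (ContinuousLinearMap.pi g)
  refine ⟨G.subtypeL.comp r, fun v => ?_, ?_, ?_⟩
  · have : ContinuousLinearMap.pi g (v : X) = e (t' v) := by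
      ext k
      simpa [f] using hg k v
    simp [r, this, t']
  · refine ContinuousLinearMap.opNorm_le_bound _ (mul_nonneg hA.nonneg (norm_nonneg _)) fun x => ?_
    have h1 : ‖r‖ ≤ c * ‖t‖ := calc
      ‖r‖ ≤ ‖(e.symm : (Fin n → 𝕜) →L[𝕜] G)‖ * ‖ContinuousLinearMap.pi g‖ :=
        ContinuousLinearMap.opNorm_comp_le _ _
      _ ≤ ‖(e.symm : (Fin n → 𝕜) →L[𝕜] G)‖ * (‖(e : G →L[𝕜] (Fin n → 𝕜))‖ * ‖t‖) := by
        gcongr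
        exact hgf.trans hf
      _ = (‖(e : G →L[𝕜] (Fin n → 𝕜))‖ * ‖(e.symm : (Fin n → 𝕜) →L[𝕜] G)‖) * ‖t‖ := by ring
      _ ≤ c * ‖t‖ := by gcongr
    exact (r.le_opNorm x).trans (by gcongr)
  · refine Submodule.finiteDimensional_of_le (S₂ := G) ?_
    rintro _ ⟨x, rfl⟩
    exact (r x).2

/-- A uniformly bounded net of operators into a finite dimensional space has a bounded operator as
pointwise limit along an ultrafilter. -/
theorem exists_clm_tendsto_of_ultrafilter {𝕜 : Type*} [RCLike 𝕜] {X W ι : Type*}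
    [NormedAddCommGroup X] [NormedSpace 𝕜 X] [NormedAddCommGroup W] [NormedSpace 𝕜 W]
    [FiniteDimensional 𝕜 W] (l : Ultrafilter ι) (u : ι → X →L[𝕜] W) {K : ℝ}
    (hK : ∀ a, ‖u a‖ ≤ K) :
    ∃ g : X →L[𝕜] W, ‖g‖ ≤ K ∧ ∀ x, Tendsto (fun a => u a x) l (𝓝 (g x)) := by
  have : ProperSpace W := FiniteDimensional.proper_rclike 𝕜 W
  have hb : ∀ x a, ‖u a x‖ ≤ K * ‖x‖ := fun x a =>
    ((u a).le_opNorm x).trans (by gcongr; exact hK a)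
  have key : ∀ x, ∃ y ∈ Metric.closedBall (0 : W) (K * ‖x‖),
      Tendsto (fun a => u a x) l (𝓝 y) := fun x => by
    refine (isCompact_closedBall (0 : W) (K * ‖x‖)).ultrafilter_le_nhds'
      (l.map fun a => u a x) ?_
    exact mem_map.2 (Filter.Eventually.of_forall fun a => by simpa using hb x a)
  choose g hg hgt using key
  obtain ⟨a⟩ := l.neBot.nonempty
  refine ⟨(linearMapOfTendsto (l := (l : Filter ι)) g (fun a => (u a : X →ₗ[𝕜] W))
    (tendsto_pi_nhds.2 hgt)).mkContinuous K fun x => ?_, ?_, fun x => hgt x⟩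
  · simpa using hg x
  · exact LinearMap.mkContinuous_norm_le _ ((norm_nonneg _).trans (hK a)) _

/-- If `A` is an `𝓛_∞`-space, then an operator `V → A → W` with `W` finite dimensional extends from
the subspace `V` to the whole space, with norm control depending on the two factors only. -/
theorem IsScriptLInftyWith.exists_extension_comp {𝕜 : Type*} [RCLike 𝕜] {A X W : Type*}
    [NormedAddCommGroup A] [NormedSpace 𝕜 A] [NormedAddCommGroup X] [NormedSpace 𝕜 X]
    [NormedAddCommGroup W] [NormedSpace 𝕜 W] [FiniteDimensional 𝕜 W]
    {c : ℝ} (hA : IsScriptLInftyWith 𝕜 A c) (V : Submodule 𝕜 X) (Q : V →L[𝕜] A) (τ : A →L[𝕜] W) :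
    ∃ g : X →L[𝕜] W, (∀ v : V, g v = τ (Q v)) ∧ ‖g‖ ≤ ‖τ‖ * (c * ‖Q‖) := by
  classical
  -- `Q` may have infinite rank, so only its restrictions to finite spans extend. The extensions
  -- need not converge in `A`, but after `τ` they do along an ultrafilter.
  have key : ∀ s : Finset V, ∃ π : X →L[𝕜] A, (∀ v ∈ s, π v = Q v) ∧ ‖π‖ ≤ c * ‖Q‖ := fun s => by
    let S : Submodule 𝕜 X := (Submodule.span 𝕜 (s : Set V)).map V.subtype
    have hS : S ≤ V := by
      rintro _ ⟨v, -, rfl⟩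
      exact v.2
    let ι : S →L[𝕜] V := S.subtypeL.codRestrict V fun x => hS x.2
    have hι : ‖ι‖ ≤ 1 := ContinuousLinearMap.opNorm_le_bound _ zero_le_one fun x => by simp [ι]
    obtain ⟨π, h1, h2, -⟩ := hA.exists_extension S (Q.comp ι) inferInstance
    refine ⟨π, fun v hv => ?_, h2.trans ?_⟩
    · exact h1 ⟨v, Submodule.mem_map_of_mem (Submodule.subset_span hv)⟩
    · refine mul_le_mul_of_nonneg_left ?_ hA.nonneg
      refine (ContinuousLinearMap.opNorm_comp_le _ _).trans ?_
      exact mul_le_of_le_one_right (norm_nonneg _) hι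
  choose π hπ hπn using key
  let l : Ultrafilter (Finset V) := Ultrafilter.of atTop
  obtain ⟨g, hg, hgt⟩ := exists_clm_tendsto_of_ultrafilter l (fun s => τ.comp (π s))
    (K := ‖τ‖ * (c * ‖Q‖)) fun s =>
      (ContinuousLinearMap.opNorm_comp_le _ _).trans (by gcongr; exact hπn s)
  refine ⟨g, fun v => ?_, hg⟩
  refine tendsto_nhds_unique (hgt v) (tendsto_const_nhds.congr' ?_)
  refine Filter.Eventually.filter_mono (Ultrafilter.of_le _) ?_
  filter_upwards [eventually_ge_atTop {v}] with s hs
  simp [hπ s v (hs (by simp))]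

/-! ### Factoring, lifting and local sections -/

/-- Purely algebraic: continuity of `U` is obtained later from preimages of controlled norm. -/
theorem LinearMap.exists_factor_of_surjective {𝕜 B C X : Type*} [Field 𝕜] [AddCommGroup B]
    [Module 𝕜 B] [AddCommGroup C] [Module 𝕜 C] [AddCommGroup X] [Module 𝕜 X]
    (p : B →ₗ[𝕜] C) (hp : Function.Surjective p) (g : B →ₗ[𝕜] X)
    (hg : ∀ b, p b = 0 → g b = 0) : ∃ U : C →ₗ[𝕜] X, ∀ b, U (p b) = g b := by
  obtain ⟨s, hs⟩ := p.exists_rightInverse_of_surjective (LinearMap.range_eq_top.2 hp)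
  refine ⟨g.comp s, fun b => ?_⟩
  have h : p (s (p b) - b) = 0 := by
    rw [map_sub, sub_eq_zero]
    exact congr($hs (p b))
  have := hg _ h
  rwa [map_sub, sub_eq_zero] at this

theorem IsShortExactSeq.comp_apply_eq_zero {𝕜 : Type*} [RCLike 𝕜] {A B C : Type*}
    [NormedAddCommGroup A] [NormedSpace 𝕜 A] [NormedAddCommGroup B] [NormedSpace 𝕜 B]
    [NormedAddCommGroup C] [NormedSpace 𝕜 C] {j : A →L[𝕜] B} {p : B →L[𝕜] C}
    (h : IsShortExactSeq j p) (a : A) : p (j a) = 0 :=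
  (h.2.1 _).2 ⟨a, rfl⟩

theorem IsShortExactSeq.isClosed_range {𝕜 : Type*} [RCLike 𝕜] {A B C : Type*}
    [NormedAddCommGroup A] [NormedSpace 𝕜 A] [NormedAddCommGroup B] [NormedSpace 𝕜 B]
    [NormedAddCommGroup C] [NormedSpace 𝕜 C] {j : A →L[𝕜] B} {p : B →L[𝕜] C}
    (h : IsShortExactSeq j p) : IsClosed (Set.range j) := by
  have : Set.range j = p ⁻¹' {0} := by
    ext b
    exact (h.2.1 b).symm
  rw [this]
  exact isClosed_singleton.preimage p.continuous

section

variable {𝕜 : Type*} [RCLike 𝕜] {A B C : Type*}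
  [NormedAddCommGroup A] [NormedSpace 𝕜 A] [CompleteSpace A]
  [NormedAddCommGroup B] [NormedSpace 𝕜 B] [CompleteSpace B]
  [NormedAddCommGroup C] [NormedSpace 𝕜 C] {j : A →L[𝕜] B} {p : B →L[𝕜] C}

/-- Operators into the middle space killed by `p` lift through `j`, with norm control. -/
theorem IsShortExactSeq.exists_lift (h : IsShortExactSeq j p) :
    ∃ M : ℝ, 0 ≤ M ∧ ∀ (V : Submodule 𝕜 B) (f : V →L[𝕜] B), (∀ v, p (f v) = 0) →
      ∃ R : V →L[𝕜] A, (∀ v, j (R v) = f v) ∧ ‖R‖ ≤ M * ‖f‖ := by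
  obtain ⟨K, hK⟩ := j.antilipschitz_of_injective_of_isClosed_range h.1 h.isClosed_range
  refine ⟨K, K.2, fun V f hf => ?_⟩
  choose R hR using fun v => (h.2.1 _).1 (hf v)
  let R' : V →ₗ[𝕜] A :=
    { toFun := R
      map_add' := fun x y => h.1 (by simp [hR])
      map_smul' := fun a x => h.1 (by simp [hR]) }
  have hb : ∀ v, ‖R' v‖ ≤ K * ‖f‖ * ‖v‖ := fun v => calc
    ‖R v‖ ≤ K * ‖j (R v)‖ := by simpa using hK.le_mul_norm_sub (x := R v) (y := 0)
    _ ≤ K * (‖f‖ * ‖v‖) := by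
      rw [hR]
      gcongr
      exact f.le_opNorm v
    _ = K * ‖f‖ * ‖v‖ := by ring
  exact ⟨R'.mkContinuous _ hb, hR, LinearMap.mkContinuous_norm_le _ (by positivity) _⟩

variable [CompleteSpace C]

/-- Finite dimensional subspaces of a quotient lift to finite dimensional subspaces, with uniform
control on the norms of the lifted vectors. -/
theorem exists_finiteDimensional_lift (hp : Function.Surjective p) :
    ∃ M : ℝ, 0 ≤ M ∧ ∀ F : Submodule 𝕜 C, FiniteDimensional 𝕜 F →
      ∃ D : Submodule 𝕜 B, FiniteDimensional 𝕜 D ∧ (∀ d ∈ D, p d ∈ F) ∧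
        ∀ f ∈ F, ∃ d ∈ D, p d = f ∧ ‖d‖ ≤ M * ‖f‖ := by
  obtain ⟨M, hM0, hM⟩ := p.exists_preimage_norm_le hp
  refine ⟨M + 1, by positivity, fun F hF => ?_⟩
  have : ProperSpace F := FiniteDimensional.proper_rclike 𝕜 F
  choose r hr hrn using hM
  obtain ⟨s₀, hs₀⟩ := (p : B →ₗ[𝕜] C).exists_rightInverse_of_surjective
    (LinearMap.range_eq_top.2 hp)
  have hs₀' : ∀ z, p (s₀ z) = z := fun z => congr($hs₀ z)
  let s : F →L[𝕜] B := LinearMap.toContinuousLinearMap (s₀.comp F.subtype)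
  have hs : ∀ f, p (s f) = f := fun f => hs₀' f
  -- The linear lift `s` has uncontrolled norm. A net this fine makes the correction `s (f - g)` at
  -- most `1`, whence the constant `M + 1`.
  obtain ⟨t, hts, htf, ht⟩ := (isCompact_sphere (0 : F) 1).finite_cover_balls
    (e := (‖s‖ + 1)⁻¹) (by positivity)
  let D₁ : Submodule 𝕜 B := LinearMap.range (s : F →ₗ[𝕜] B)
  let D₂ : Submodule 𝕜 B := Submodule.span 𝕜 ((fun f : F => r f) '' t)
  have : FiniteDimensional 𝕜 D₂ := FiniteDimensional.span_of_finite 𝕜 (htf.image _)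
  refine ⟨D₁ ⊔ D₂, inferInstance, ?_, ?_⟩
  · suffices D₁ ⊔ D₂ ≤ F.comap (p : B →ₗ[𝕜] C) from fun d hd => this hd
    refine sup_le ?_ (Submodule.span_le.2 ?_)
    · rintro _ ⟨f, rfl⟩
      change p (s f) ∈ F
      rw [hs]
      exact f.2
    · rintro _ ⟨f, -, rfl⟩
      change p (r f) ∈ F
      rw [hr]
      exact f.2
  · have unit : ∀ f : F, ‖f‖ = 1 → ∃ d ∈ D₁ ⊔ D₂, p d = f ∧ ‖d‖ ≤ M + 1 := fun f hf => by
      obtain ⟨g, hg, hfg⟩ := Set.mem_iUnion₂.1 (ht (by simpa using hf : f ∈ Metric.sphere 0 1))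
      have hg1 : ‖g‖ = 1 := by simpa using hts hg
      refine ⟨r g + s (f - g), ?_, by simp [hr, hs], ?_⟩
      · exact add_mem (Submodule.mem_sup_right (Submodule.subset_span ⟨g, hg, rfl⟩))
          (Submodule.mem_sup_left ⟨_, rfl⟩)
      · refine (norm_add_le _ _).trans (add_le_add ?_ ?_)
        · exact (hrn _).trans (mul_le_of_le_one_right hM0.le hg1.le)
        · rw [Metric.mem_ball, dist_eq_norm] at hfg
          refine (s.le_opNorm _).trans ?_
          calc ‖s‖ * ‖f - g‖ ≤ (‖s‖ + 1) * (‖s‖ + 1)⁻¹ := by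
                gcongr
                linarith
            _ = 1 := mul_inv_cancel₀ (by positivity)
    intro f hf
    by_cases h0 : f = 0
    · exact ⟨0, zero_mem _, by simp [h0], by simp [h0]⟩
    have h0' : ‖f‖ ≠ 0 := norm_ne_zero_iff.2 h0
    obtain ⟨d, hd, hpd, hdn⟩ := unit ((‖f‖⁻¹ : 𝕜) • ⟨f, hf⟩) (by
      rw [norm_smul]; simp [h0'])
    refine ⟨(‖f‖ : 𝕜) • d, Submodule.smul_mem _ _ hd, ?_, ?_⟩
    · rw [map_smul, hpd]
      simp [smul_smul, h0']
    · rw [norm_smul, RCLike.norm_ofReal, abs_norm, mul_comm]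
      gcongr

/-- A quotient by an `𝓛_∞`-space has uniformly bounded local sections. -/
theorem IsShortExactSeq.exists_section (h : IsShortExactSeq j p) (hA : IsScriptLInfty 𝕜 A) :
    ∃ K : ℝ, 0 ≤ K ∧ ∀ F : Submodule 𝕜 C, FiniteDimensional 𝕜 F →
      ∃ s : F →L[𝕜] B, (∀ f, p (s f) = f) ∧ ‖s‖ ≤ K := by
  obtain ⟨c, hA⟩ := hA
  have hc := hA.nonneg
  obtain ⟨L, hL0, hL⟩ := h.exists_lift
  obtain ⟨M, hM0, hM⟩ := exists_finiteDimensional_lift h.2.2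
  refine ⟨(1 + ‖j‖ * (c * L)) * M, by positivity, fun F hF => ?_⟩
  obtain ⟨D, hD, hDF, hFD⟩ := hM F hF
  let V : Submodule 𝕜 B := D ⊓ LinearMap.ker (p : B →ₗ[𝕜] C)
  obtain ⟨R, hR, hRn⟩ := hL V V.subtypeL fun v => v.2.2
  obtain ⟨π, hπ, hπn, -⟩ := hA.exists_extension V R inferInstance
  have hπn' : ‖π‖ ≤ c * L := by
    refine hπn.trans (mul_le_mul_of_nonneg_left (hRn.trans ?_) hc)
    exact mul_le_of_le_one_right hL0 V.norm_subtypeL_le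
  -- `g` vanishes on `D ∩ ker p` and satisfies `p ∘ g = p`, so on `D` it factors through `F` as a
  -- section.
  let g : B →L[𝕜] B := ContinuousLinearMap.id 𝕜 B - j.comp π
  have hg : ‖g‖ ≤ 1 + ‖j‖ * (c * L) := by
    refine (norm_sub_le _ _).trans (add_le_add ContinuousLinearMap.norm_id_le ?_)
    exact (ContinuousLinearMap.opNorm_comp_le _ _).trans (by gcongr)
  let pD : D →ₗ[𝕜] F := (p : B →ₗ[𝕜] C).restrict hDF
  have hpD : Function.Surjective pD := fun f => by
    obtain ⟨d, hd, hdf, -⟩ := hFD f f.2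
    exact ⟨⟨d, hd⟩, Subtype.ext hdf⟩
  obtain ⟨U, hU⟩ := pD.exists_factor_of_surjective hpD ((g : B →ₗ[𝕜] B).comp D.subtype)
    fun d hd => by
      have hdV : (d : B) ∈ V := ⟨d.2, congr_arg Subtype.val hd⟩
      have h1 := hπ ⟨d, hdV⟩
      have h2 := hR ⟨d, hdV⟩
      simp only at h1
      simp [g, h1, h2]
  have hUs : ∀ f : F, p (U f) = f := fun f => by
    obtain ⟨d, rfl⟩ := hpD f
    rw [hU]
    simp [g, h.comp_apply_eq_zero, pD]
  have hUn : ∀ f : F, ‖U f‖ ≤ (1 + ‖j‖ * (c * L)) * M * ‖f‖ := fun f => by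
    obtain ⟨d, hd, hdf, hdn⟩ := hFD f f.2
    have : U f = g d := by
      rw [show f = pD ⟨d, hd⟩ from Subtype.ext hdf.symm, hU]
      rfl
    rw [this, mul_assoc]
    refine (g.le_opNorm d).trans ?_
    gcongr
    exact hdn
  exact ⟨U.mkContinuous _ hUn, hUs, LinearMap.mkContinuous_norm_le _ (by positivity) _⟩

/-! ### Transfer of the BAP between the middle and right terms -/

/-- Lifting `T ∘ p` by a local section gives `u`, correct on `F` modulo `j(A)`; the defect on `F` is
a finite rank operator into `A`, which extends to `B`. -/
theorem IsShortExactSeq.hasBAP_middle (h : IsShortExactSeq j p) (hA : IsScriptLInfty 𝕜 A)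
    (hC : HasBAP 𝕜 C) : HasBAP 𝕜 B := by
  obtain ⟨K, hK0, hK⟩ := h.exists_section hA
  obtain ⟨c, hA⟩ := hA
  obtain ⟨b, hC⟩ := hC
  have hc := hA.nonneg
  obtain ⟨L, hL0, hL⟩ := h.exists_lift
  refine ⟨K * (b * ‖p‖) + ‖j‖ * (c * (L * (1 + K * (b * ‖p‖)))), fun F hF => ?_⟩
  obtain ⟨T, hT, hTn, hTF⟩ := hC (F.map (p : B →ₗ[𝕜] C)) inferInstance
  obtain ⟨s, hs, hsn⟩ := hK _ hT
  let T' : C →L[𝕜] LinearMap.range (T : C →ₗ[𝕜] C) := T.codRestrict _ fun x => ⟨x, rfl⟩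
  have hT'n : ‖T'‖ ≤ b :=
    (ContinuousLinearMap.opNorm_le_bound _ (norm_nonneg _) fun v => T.le_opNorm v).trans hTn
  let u : B →L[𝕜] B := s.comp (T'.comp p)
  have hun : ‖u‖ ≤ K * (b * ‖p‖) := by
    refine (ContinuousLinearMap.opNorm_comp_le _ _).trans ?_
    refine mul_le_mul hsn ?_ (norm_nonneg _) hK0
    exact (ContinuousLinearMap.opNorm_comp_le _ _).trans (by gcongr)
  have hpu : ∀ f ∈ F, p (u f) = p f := fun f hf => by
    simp only [u, ContinuousLinearMap.comp_apply, hs]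
    exact hTF _ (Submodule.mem_map_of_mem hf)
  have hu : FiniteDimensional 𝕜 (LinearMap.range (u : B →ₗ[𝕜] B)) := by
    refine Submodule.finiteDimensional_of_le (S₂ := LinearMap.range (s : LinearMap.range (T : C →ₗ[𝕜] C) →ₗ[𝕜] B)) ?_
    rintro _ ⟨x, rfl⟩
    exact ⟨T' (p x), rfl⟩
  obtain ⟨R, hR, hRn⟩ := hL F ((ContinuousLinearMap.id 𝕜 B - u).comp F.subtypeL) fun v => by
    simp [hpu v v.2]
  obtain ⟨g, hg, hgn, hgr⟩ := hA.exists_extension F R inferInstance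
  have hRn' : ‖R‖ ≤ L * (1 + K * (b * ‖p‖)) := by
    refine hRn.trans (mul_le_mul_of_nonneg_left ?_ hL0)
    refine (ContinuousLinearMap.opNorm_comp_le _ _).trans ?_
    refine (mul_le_of_le_one_right (norm_nonneg _) F.norm_subtypeL_le).trans ?_
    exact (norm_sub_le _ _).trans (add_le_add ContinuousLinearMap.norm_id_le hun)
  refine ⟨u + j.comp g, ?_, ?_, fun f hf => ?_⟩
  · refine Submodule.finiteDimensional_of_le (S₂ := LinearMap.range (u : B →ₗ[𝕜] B) ⊔
      (LinearMap.range (g : B →ₗ[𝕜] A)).map (j : A →ₗ[𝕜] B)) ?_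
    rintro _ ⟨x, rfl⟩
    exact add_mem (Submodule.mem_sup_left ⟨x, rfl⟩)
      (Submodule.mem_sup_right (Submodule.mem_map_of_mem ⟨x, rfl⟩))
  · refine (norm_add_le _ _).trans (add_le_add hun ?_)
    refine (ContinuousLinearMap.opNorm_comp_le _ _).trans ?_
    gcongr
    exact hgn.trans (by gcongr)
  · have h1 := hg ⟨f, hf⟩
    have h2 := hR ⟨f, hf⟩
    simp only at h1
    simp [h1, h2]

/-- With `T` fixing a lift of `F`, the operator `p ∘ T` need not kill `j(A)`. Subtracting a `g` that
agrees with it on `j(A)` and vanishes on the lift lets it descend to `C`. -/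
theorem IsShortExactSeq.hasBAP_right (h : IsShortExactSeq j p) (hA : IsScriptLInfty 𝕜 A)
    (hB : HasBAP 𝕜 B) : HasBAP 𝕜 C := by
  obtain ⟨K, hK0, hK⟩ := h.exists_section hA
  obtain ⟨c, hA⟩ := hA
  obtain ⟨b, hB⟩ := hB
  have hc := hA.nonneg
  obtain ⟨L, hL0, hL⟩ := h.exists_lift
  obtain ⟨M, hM0, hM⟩ := p.exists_preimage_norm_le h.2.2
  refine ⟨(‖p‖ * b + ‖p‖ * b * ‖j‖ * (c * (L * (1 + K * ‖p‖)))) * M, fun F hF => ?_⟩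
  obtain ⟨s, hs, hsn⟩ := hK F hF
  obtain ⟨T, hT, hTn, hTF⟩ := hB (LinearMap.range (s : F →ₗ[𝕜] B)) inferInstance
  have hb : 0 ≤ b := (norm_nonneg _).trans hTn
  let W : Submodule 𝕜 C := (LinearMap.range (T : B →ₗ[𝕜] B)).map (p : B →ₗ[𝕜] C)
  let t : B →L[𝕜] W := (p.comp T).codRestrict W fun x => Submodule.mem_map_of_mem ⟨x, rfl⟩
  have htn : ‖t‖ ≤ ‖p‖ * b := by
    refine (ContinuousLinearMap.opNorm_le_bound _ (norm_nonneg _)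
      fun v => (p.comp T).le_opNorm v).trans ?_
    exact (ContinuousLinearMap.opNorm_comp_le _ _).trans (by gcongr)
  let V : Submodule 𝕜 B := F.comap (p : B →ₗ[𝕜] C)
  let pV : V →L[𝕜] F := (p.comp V.subtypeL).codRestrict F fun v => v.2
  have hpV : ‖pV‖ ≤ ‖p‖ :=
    ContinuousLinearMap.opNorm_le_bound _ (norm_nonneg _) fun v => p.le_opNorm v
  -- `Q` is the projection of `V = p⁻¹(F)` onto `A` along `s(F)`: `Q ∘ j = id` and `Q ∘ s = 0`.
  obtain ⟨Q, hQ, hQn⟩ := hL V (V.subtypeL - s.comp pV) fun v => by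
    have : p (s (pV v)) = p v := hs _
    simp [this]
  have hQn' : ‖Q‖ ≤ L * (1 + K * ‖p‖) := by
    refine hQn.trans (mul_le_mul_of_nonneg_left ?_ hL0)
    refine (norm_sub_le _ _).trans (add_le_add V.norm_subtypeL_le ?_)
    exact (ContinuousLinearMap.opNorm_comp_le _ _).trans (by gcongr)
  obtain ⟨g, hg, hgn⟩ := hA.exists_extension_comp V Q (t.comp j)
  have hgn' : ‖t - g‖ ≤ ‖p‖ * b + ‖p‖ * b * ‖j‖ * (c * (L * (1 + K * ‖p‖))) := by
    refine (norm_sub_le _ _).trans (add_le_add htn (hgn.trans ?_))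
    have : ‖t.comp j‖ ≤ ‖p‖ * b * ‖j‖ :=
      (ContinuousLinearMap.opNorm_comp_le _ _).trans (by gcongr)
    gcongr
  have hgV : ∀ v : V, g v = t v - t (s (pV v)) := fun v => by
    rw [hg, ContinuousLinearMap.comp_apply, hQ]
    simp
  obtain ⟨U, hU⟩ := (p : B →ₗ[𝕜] C).exists_factor_of_surjective h.2.2
    ((t - g : B →L[𝕜] W) : B →ₗ[𝕜] W) fun d hd => by
      have hd' : p d = 0 := hd
      have hdV : d ∈ V := by simp [V, hd']
      have h1 := hgV ⟨d, hdV⟩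
      have h2 : pV ⟨d, hdV⟩ = 0 := Subtype.ext hd'
      simp only [h2, map_zero, sub_zero] at h1
      simp [h1]
  have hU' : ∀ d, U (p d) = t d - g d := hU
  have hUn : ∀ z, ‖(W.subtype.comp U) z‖ ≤
      (‖p‖ * b + ‖p‖ * b * ‖j‖ * (c * (L * (1 + K * ‖p‖)))) * M * ‖z‖ := fun z => by
    obtain ⟨d, rfl, hdn⟩ := hM z
    have : ‖(W.subtype.comp U) (p d)‖ = ‖(t - g) d‖ := congr_arg (fun w : W => ‖(w : C)‖) (hU' d)
    rw [this, mul_assoc]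
    exact ((t - g).le_opNorm d).trans (by gcongr)
  refine ⟨(W.subtype.comp U).mkContinuous _ hUn, ?_,
    LinearMap.mkContinuous_norm_le _ (by positivity) _, fun f hf => ?_⟩
  · refine Submodule.finiteDimensional_of_le (S₂ := W) ?_
    rintro _ ⟨x, rfl⟩
    exact (U x).2
  · have hsf : p (s ⟨f, hf⟩) = f := hs ⟨f, hf⟩
    have hsV : s ⟨f, hf⟩ ∈ V := by simp [V, hsf, hf]
    have h1 := hgV ⟨_, hsV⟩
    have h2 : pV ⟨_, hsV⟩ = ⟨f, hf⟩ := Subtype.ext hsf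
    simp only [h2, sub_self] at h1
    have h3 : U f = t (s ⟨f, hf⟩) := by
      have h5 := hU' (s ⟨f, hf⟩)
      rwa [hsf, h1, sub_zero] at h5
    have h4 : T (s ⟨f, hf⟩) = s ⟨f, hf⟩ := hTF _ ⟨_, rfl⟩
    calc ((U f : W) : C) = p (T (s ⟨f, hf⟩)) := by rw [h3]; rfl
      _ = f := by rw [h4, hsf]

end

/-! ### Push-out and conclusion -/

/-- The push-out of two short exact sequences with the same left term. -/
theorem IsShortExactSeq.exists_pushout {𝕜 : Type*} [RCLike 𝕜] {Y : Type*} {E : Type u} {Z : Type*}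
    {E' : Type v} {Z' : Type*}
    [NormedAddCommGroup Y] [NormedSpace 𝕜 Y] [CompleteSpace Y]
    [NormedAddCommGroup E] [NormedSpace 𝕜 E] [CompleteSpace E]
    [NormedAddCommGroup Z] [NormedSpace 𝕜 Z]
    [NormedAddCommGroup E'] [NormedSpace 𝕜 E'] [CompleteSpace E']
    [NormedAddCommGroup Z'] [NormedSpace 𝕜 Z']
    {i : Y →L[𝕜] E} {q : E →L[𝕜] Z} (h : IsShortExactSeq i q)
    {i' : Y →L[𝕜] E'} {q' : E' →L[𝕜] Z'} (h' : IsShortExactSeq i' q') :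
    ∃ (P : Type (max u v)) (_ : NormedAddCommGroup P) (_ : NormedSpace 𝕜 P) (_ : CompleteSpace P)
      (k : E →L[𝕜] P) (r : P →L[𝕜] Z') (k' : E' →L[𝕜] P) (r' : P →L[𝕜] Z),
      IsShortExactSeq k r ∧ IsShortExactSeq k' r' := by
  let d : Y →L[𝕜] E × E' := i.prod (-i')
  -- The first coordinate alone bounds `d` below; closed range makes the quotient a Banach space.
  have hd : Topology.IsClosedEmbedding d := by
    obtain ⟨K, hK⟩ := i.antilipschitz_of_injective_of_isClosed_range h.1 h.isClosed_range
    refine AntilipschitzWith.isClosedEmbedding (K := K) (fun x y => (hK x y).trans ?_)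
      d.uniformContinuous
    gcongr
    exact le_max_left _ _
  let S : Submodule 𝕜 (E × E') := LinearMap.range (d : Y →ₗ[𝕜] E × E')
  have hS : IsClosed (S : Set (E × E')) := hd.isClosed_range
  have : IsClosed (S.toAddSubgroup : Set (E × E')) := hS
  have hmem : ∀ x : E × E', S.mkQL x = 0 ↔ ∃ y, i y = x.1 ∧ -i' y = x.2 := fun x => by
    rw [Submodule.mkQL_apply, Submodule.mkQ_apply, Submodule.Quotient.mk_eq_zero]
    exact exists_congr fun y => Prod.ext_iff
  let r : (E × E') ⧸ S →L[𝕜] Z' := S.liftQL (q'.comp (ContinuousLinearMap.snd 𝕜 E E')) (by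
    rintro _ ⟨y, rfl⟩
    simp [d, h'.comp_apply_eq_zero])
  let r' : (E × E') ⧸ S →L[𝕜] Z := S.liftQL (q.comp (ContinuousLinearMap.fst 𝕜 E E')) (by
    rintro _ ⟨y, rfl⟩
    simp [d, h.comp_apply_eq_zero])
  have hr : ∀ x, r (S.mkQL x) = q' x.2 := fun x => rfl
  have hr' : ∀ x, r' (S.mkQL x) = q x.1 := fun x => rfl
  refine ⟨(E × E') ⧸ S, inferInstance, inferInstance, inferInstance,
    S.mkQL.comp (ContinuousLinearMap.inl 𝕜 E E'), r,
    S.mkQL.comp (ContinuousLinearMap.inr 𝕜 E E'), r', ⟨?_, ?_, ?_⟩, ⟨?_, ?_, ?_⟩⟩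
  · refine (injective_iff_map_eq_zero _).2 fun x hx => ?_
    obtain ⟨y, h1, h2⟩ := (hmem _).1 hx
    have : y = 0 := h'.1 (by simpa using h2)
    simpa [this] using h1.symm
  · intro z
    obtain ⟨x, rfl⟩ := S.mkQ_surjective z
    refine ⟨fun hx => ?_, ?_⟩
    · obtain ⟨y, hy⟩ := (h'.2.1 _).1 hx
      -- The quotient identifies `(0, i' y)` with `(i y, 0)`.
      refine ⟨x.1 + i y, sub_eq_zero.1 ?_⟩
      refine (map_sub S.mkQL (x.1 + i y, 0) x).symm.trans ((hmem _).2 ⟨y, ?_, ?_⟩) <;> simp [hy]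
    · rintro ⟨x', hx'⟩
      rw [← hx']
      exact map_zero q'
  · intro z
    obtain ⟨x, rfl⟩ := h'.2.2 z
    exact ⟨S.mkQL (0, x), rfl⟩
  · refine (injective_iff_map_eq_zero _).2 fun x hx => ?_
    obtain ⟨y, h1, h2⟩ := (hmem _).1 hx
    have : y = 0 := h.1 (by simpa using h1)
    simpa [this] using h2.symm
  · intro z
    obtain ⟨x, rfl⟩ := S.mkQ_surjective z
    refine ⟨fun hx => ?_, ?_⟩
    · obtain ⟨y, hy⟩ := (h.2.1 _).1 hx
      refine ⟨x.2 + i' y, sub_eq_zero.1 ?_⟩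
      refine (map_sub S.mkQL (0, x.2 + i' y) x).symm.trans ((hmem _).2 ⟨-y, ?_, ?_⟩) <;> simp [hy]
    · rintro ⟨x', hx'⟩
      rw [← hx']
      exact map_zero q
  · intro z
    obtain ⟨x, rfl⟩ := h.2.2 z
    exact ⟨S.mkQL (x, 0), rfl⟩

theorem proposition3p3 {𝕜 : Type*} [RCLike 𝕜] {Y E Z E' Z' : Type*}
    [NormedAddCommGroup Y] [NormedSpace 𝕜 Y] [CompleteSpace Y]
    [NormedAddCommGroup E] [NormedSpace 𝕜 E] [CompleteSpace E]
    [NormedAddCommGroup Z] [NormedSpace 𝕜 Z] [CompleteSpace Z]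
    [NormedAddCommGroup E'] [NormedSpace 𝕜 E'] [CompleteSpace E']
    [NormedAddCommGroup Z'] [NormedSpace 𝕜 Z'] [CompleteSpace Z']
    (hE : IsScriptLInfty 𝕜 E) (hE' : IsScriptLInfty 𝕜 E')
    (i : Y →L[𝕜] E) (q : E →L[𝕜] Z) (h : IsShortExactSeq i q)
    (i' : Y →L[𝕜] E') (q' : E' →L[𝕜] Z') (h' : IsShortExactSeq i' q') :
    HasBAP 𝕜 Z ↔ HasBAP 𝕜 Z' := by
  obtain ⟨P, _, _, _, k, r, k', r', hk, hk'⟩ := h.exists_pushout h'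
  exact ⟨fun hZ => hk.hasBAP_right hE (hk'.hasBAP_middle hE' hZ),
    fun hZ' => hk'.hasBAP_right hE' (hk.hasBAP_middle hE hZ')⟩
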